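/- Let $p,q\ge 1$ be integers and let $a(z)=\sum_{m=-q}^{p}a_m z^m$ be a Laurent polynomial with complex coefficients such that $a_p\neq 0$, $a_{-q}\neq 0$ and $\gcd\{m\in\mathbb Z: a_m\neq 0\}=1$. For every $\lambda\in\mathbb C$ let $z_1(\lambda),\dots,z_{p+q}(\lambda)$ be the solutions of $a(z)-\lambda=0$, listed with multiplicity and numbered (arbitrarily in case of ties) so that $$0<|z_1(\lambda)|\le |z_2(\lambda)|\le\cdots\le|z_{p+q}(\lambda)|.$$ Let $k\in\{-q+1,\dots,p-1\}$ and put $$\Gamma_k=\{\lambda\in\mathbb C:\ |z_{q+k}(\lambda)|=|z_{q+k+1}(\lambda)|\},\qquad M_k=\{q+k+1,\dots,p+q\}.$$ For $n\ge 1$ let $P_{k,n}(\lambda)=\det T_n\big(z^{-k}(a-\lambda)\big)$, where $T_n(b)=(b_{i-j})_{i,j=1}^n$ is the Toeplitz matrix of a Laurent polynomial $b(z)=\sum_m b_m z^m$. Define $$w_{M_k}(\lambda)=(-1)^{p-k}a_p\prod_{j\in M_k}z_j(\lambda),\qquad C_{M_k}(\lambda)=\prod_{j\in M_k}z_j(\lambda)^{q+k}\prod_{\substack{j\in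 M_k\\ l\in\{1,\dots,p+q\}\setminus M_k}}\frac1{z_j(\lambda)-z_l(\lambda)}.$$ Then for every compact set $K\subset\mathbb C\setminus\Gamma_k$ there is a constant $c_K>0$ such that $$P_{k,n}(\lambda)=w_{M_k}(\lambda)^n\,C_{M_k}(\lambda)\,\bigl(1+O(e^{-c_K n})\bigr),\qquad n\to\infty,$$ uniformly for $\lambda\in K$; that is, there are $c_K>0$, $B$ and $N$ such that for all $n\ge N$ and $\lambda\in K$ one has $P_{k,n}(\lambda)=w_{M_k}(\lambda)^nC_{M_k}(\lambda)(1+R_n(\lambda))$ with $|R_n(\lambda)|\le B e^{-c_K n}$. -/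

import Mathlib

namespace BandedToeplitz

open LaurentPolynomial (C T)

/-- The symbol `a(z) = ∑_{m=-q}^{p} a_m z^m`, given as a Laurent polynomial, with `p, q ≥ 1`,
`a_p ≠ 0`, `a_{-q} ≠ 0`, and `gcd {m : a_m ≠ 0} = 1`. The coefficient `a_m` is `a.coeff m`; it is
the `m`-th Fourier coefficient of the restriction of `a` to the unit circle. -/
structure IsBandedSymbol (p q : ℕ) (a : LaurentPolynomial ℂ) : Prop where
  one_le_p : 1 ≤ p
  one_le_q : 1 ≤ q
  support_subset : a.coeff.support ⊆ Finset.Icc (-(q : ℤ)) (p : ℤ)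
  coeff_p_ne_zero : a.coeff (p : ℤ) ≠ 0
  coeff_neg_q_ne_zero : a.coeff (-(q : ℤ)) ≠ 0
  gcd_eq_one : a.coeff.support.gcd id = 1

/-- The `n × n` Toeplitz matrix `T_n(b)` of a Laurent polynomial symbol `b`:
its `(i, j)` entry is `b_{i-j}`. -/
noncomputable def toeplitz (n : ℕ) (b : LaurentPolynomial ℂ) : Matrix (Fin n) (Fin n) ℂ :=
  Matrix.of fun i j => b.coeff (((i : ℕ) : ℤ) - ((j : ℕ) : ℤ))

/-- `P_{k,n}(lam) = det T_n(z^{-k} (a - lam))`. -/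
noncomputable def P (a : LaurentPolynomial ℂ) (k : ℤ) (n : ℕ) (lam : ℂ) : ℂ :=
  (toeplitz n (T (-k) * (a - C lam))).det

/-- `z 1, …, z (p + q)` are the solutions of `a(z) - lam = 0`, listed with multiplicity, that is
`a(z) - lam = a_p z^{-q} ∏_j (z - z_j)`, and numbered by nondecreasing absolute value.
The values of `z` outside `{1, …, p + q}` are irrelevant. -/
structure IsOrderedSolutions (p q : ℕ) (a : LaurentPolynomial ℂ) (lam : ℂ) (z : ℤ → ℂ) :
    Prop where
  factorization : a - C lam =
    C (a.coeff (p : ℤ)) * T (-(q : ℤ)) * ∏ j ∈ Finset.Icc (1 : ℤ) (p + q), (T 1 - C (z j))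
  norm_le_norm : ∀ i j : ℤ, 1 ≤ i → i ≤ j → j ≤ p + q → ‖z i‖ ≤ ‖z j‖

/-- Every `lam` admits an ordered list of solutions. -/
theorem exists_isOrderedSolutions {p q : ℕ} {a : LaurentPolynomial ℂ}
    (ha : IsBandedSymbol p q a) (lam : ℂ) : ∃ z : ℤ → ℂ, IsOrderedSolutions p q a lam z := by
  have hp := ha.one_le_p
  have hq := ha.one_le_q
  set b : LaurentPolynomial ℂ := a - C lam with hb
  have hbc : ∀ m : ℤ, b.coeff m = a.coeff m - if m = 0 then lam else 0 := by
    intro m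
    rw [hb, ← LaurentPolynomial.single_eq_C]
    by_cases h : m = 0 <;> simp [h]
  have hbp : b.coeff (p : ℤ) = a.coeff (p : ℤ) := by
    rw [hbc, if_neg (by omega), sub_zero]
  have hb0 : ∀ m : ℤ, m < -q ∨ (p : ℤ) < m → b.coeff m = 0 := by
    intro m hm
    have h1 : a.coeff m = 0 := by
      by_contra h
      have := Finset.mem_Icc.mp (ha.support_subset (Finsupp.mem_support_iff.mpr h))
      omega
    rw [hbc, h1, if_neg (by omega), sub_zero]
  set f : Polynomial ℂ :=
    ∑ m ∈ Finset.range (p + q + 1), Polynomial.monomial m (b.coeff ((m : ℤ) - q)) with hf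
  have hfc : ∀ m : ℕ, f.coeff m = b.coeff ((m : ℤ) - q) := by
    intro m
    rw [hf, Polynomial.finsetSum_coeff]
    simp only [Polynomial.coeff_monomial, Finset.sum_ite_eq', Finset.mem_range]
    split_ifs with h
    · rfl
    · exact (hb0 _ (by omega)).symm
  have hlc : f.coeff (p + q) = a.coeff (p : ℤ) := by
    rw [hfc, ← hbp]; congr 1; push_cast; ring
  have hdeg : f.natDegree = p + q := by
    apply le_antisymm
    · rw [Polynomial.natDegree_le_iff_coeff_eq_zero]
      intro m hm
      rw [hfc]; exact hb0 _ (by omega)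
    · apply Polynomial.le_natDegree_of_ne_zero
      rw [hlc]; exact ha.coeff_p_ne_zero
  have hL : b = T (-(q : ℤ)) * Polynomial.toLaurent f := by
    have h1 : Polynomial.toLaurent f = T (q : ℤ) * b := by
      have h2 : b = ∑ m ∈ Finset.range (p + q + 1),
          C (b.coeff ((m : ℤ) - q)) * T ((m : ℤ) - q) := by
        apply LaurentPolynomial.ext
        intro m
        simp only [← LaurentPolynomial.single_eq_C_mul_T, AddMonoidAlgebra.coeff_sum,
          Finsupp.finsetSum_apply, AddMonoidAlgebra.coeff_single, Finsupp.single_apply]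
        by_cases hm : -(q : ℤ) ≤ m ∧ m ≤ p
        · rw [Finset.sum_eq_single (m + q).toNat]
          · have : ((m + q).toNat : ℤ) - q = m := by omega
            rw [if_pos this, this]
          · intro i _ hi
            rw [if_neg (by omega)]
          · intro h
            exact absurd (Finset.mem_range.mpr (by omega)) h
        · rw [hb0 m (by omega)]
          symm
          apply Finset.sum_eq_zero
          intro i hi
          have := Finset.mem_range.mp hi
          rw [if_neg (by omega)]
      conv_rhs => rw [h2]
      rw [hf, map_sum, Finset.mul_sum]
      apply Finset.sum_congr rfl
      intro m _
      rw [← Polynomial.C_mul_X_pow_eq_monomial, Polynomial.toLaurent_C_mul_X_pow,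
        mul_left_comm, ← LaurentPolynomial.T_add]
      congr 2; ring
    rw [h1, ← mul_assoc, ← LaurentPolynomial.T_add]
    simp
  have hcard : f.roots.card = p + q := by
    rw [← hdeg]; exact (IsAlgClosed.splits f).natDegree_eq_card_roots.symm
  have hlen : f.roots.toList.length = p + q := by simpa using hcard
  set r : Fin (p + q) → ℂ := fun i => f.roots.toList.get (i.cast hlen.symm) with hr
  set σ := Tuple.sort (fun i => ‖r i‖) with hσ
  have hmono : Monotone (fun i => ‖r (σ i)‖) := Tuple.monotone_sort (fun i => ‖r i‖)
  have hprod : f = Polynomial.C (a.coeff (p : ℤ)) *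
      ∏ i : Fin (p + q), (Polynomial.X - Polynomial.C (r (σ i))) := by
    rw [Equiv.prod_comp σ (fun i => Polynomial.X - Polynomial.C (r i))]
    conv_lhs => rw [(IsAlgClosed.splits f).eq_prod_roots]
    rw [Polynomial.leadingCoeff, hdeg, hlc]
    congr 1
    rw [← Multiset.coe_toList f.roots, Multiset.map_coe, Multiset.prod_coe,
      ← List.prod_ofFn]
    congr 1
    apply List.ext_get
    · simp [hlen]
    · intro i h1 h2
      simp [hr]
  refine ⟨fun j => if h : (j - 1).toNat < p + q then r (σ ⟨(j - 1).toNat, h⟩) else 0, ?_, ?_⟩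
  · rw [← hb, hL, hprod, map_mul, Polynomial.toLaurent_C, map_prod, mul_comm (C _) (T _),
      mul_assoc]
    congr 2
    refine Finset.prod_bij (fun i _ => ((i : ℕ) : ℤ) + 1) ?_ ?_ ?_ ?_
    · intro i _
      have := i.2
      exact Finset.mem_Icc.mpr ⟨by omega, by omega⟩
    · intro i _ j _ h
      apply Fin.ext
      omega
    · intro j hj
      have := Finset.mem_Icc.mp hj
      exact ⟨⟨(j - 1).toNat, by omega⟩, Finset.mem_univ _, by simp; omega⟩
    · intro i _
      simp
  · intro i j hi hij hj
    have h1 : (i - 1).toNat < p + q := by omega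
    have h2 : (j - 1).toNat < p + q := by omega
    simp only [h1, h2, dif_pos]
    apply hmono
    exact Fin.mk_le_mk.mpr (by omega)

/-- `Γ_k = {lam : |z_{q+k}(lam)| = |z_{q+k+1}(lam)|}`. The absolute values do not depend on the
chosen numbering of the solutions. -/
def Gam (p q : ℕ) (a : LaurentPolynomial ℂ) (k : ℤ) : Set ℂ :=
  {lam | ∃ z : ℤ → ℂ, IsOrderedSolutions p q a lam z ∧ ‖z (q + k)‖ = ‖z (q + k + 1)‖}

/-- `w_M = (-1)^{p-k} a_p ∏_{j ∈ M} z_j`, where `z` is the list of solutions at `lam`. -/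
noncomputable def w (p : ℕ) (a : LaurentPolynomial ℂ) (k : ℤ) (M : Finset ℤ) (z : ℤ → ℂ) : ℂ :=
  (-1) ^ ((p : ℤ) - k) * a.coeff (p : ℤ) * ∏ j ∈ M, z j

/-- `C_M = ∏_{j ∈ M} z_j^{q+k} ∏_{j ∈ M, l ∉ M} (z_j - z_l)⁻¹`, where `z` is the list of solutions
at `lam` and `l` runs over the complement of `M` in `{1, …, p + q}`. -/
noncomputable def CM (p q : ℕ) (k : ℤ) (M : Finset ℤ) (z : ℤ → ℂ) : ℂ :=
  (∏ j ∈ M, z j ^ ((q : ℤ) + k)) *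
    ∏ j ∈ M, ∏ l ∈ Finset.Icc (1 : ℤ) (p + q) \ M, (z j - z l)⁻¹

/-- `M_k = {q + k + 1, …, p + q}`. -/
noncomputable def Mk (p q : ℕ) (k : ℤ) : Finset ℤ :=
  Finset.Icc ((q : ℤ) + k + 1) (p + q)

end BandedToeplitz

namespace BandedToeplitz

open Polynomial

/-! Up to the factor `a_p ^ n`, the determinant is that of the Toeplitz matrix of `g G`, where `g =
∏ (X - x_i)` carries the `r = q + k` smallest roots and `G = ∏ (X - y_j)` the `s = p - k` largest.

In the polynomials of degree below `r + n + s`, complete the columns `g G X^j` (`j < n`) by the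
monomials of degree below `r` and the `s` monomials `X^(n+r+j)`: the determinant is still the
Toeplitz one. With `g X^(n+j)` in place of the top monomials it is `G(0)^n`. The quotient is the
determinant of the `s × s` block `d` in the expansions `X^(n+r+j) = ρ_j + g G β_j + g X^n d_j`,
where `deg ρ_j < r`, `deg β_j < n`, `deg d_j < s`.

Evaluating at a matrix `A` with `g(A) = 0` determines `ρ`; evaluating at `Y` with `G(Y) = 0` then
determines `d`. This gives the exact formula `det_toeplitz_mul`, whose factor `det (1 - E)` has an
`E` depending on `n` only through `Y^(-(n+r))` and `A^(n+r)`.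

To allow multiple roots, `A` and `Y` are bidiagonal, with the roots on the diagonal and a small `ε`
below it. They are cyclic, continuous in the roots, and `‖A‖`, `‖Y⁻¹‖` are nearly `max |x_i|` and `1
/ min |y_j|`. Off `Γ_k` all `|x_i| < |y_j|`, so `E` decays exponentially
(`exists_det_toeplitz_asymptotics`). Uniformity comes from compactness of the set of all ordered
root lists over `K`; no continuous choice of roots is needed. -/

/-! ### Coefficient matrices and evaluation of polynomial families at a matrix. -/

/-- The matrix of the coefficients of a family of polynomials at the exponents `e`. -/
noncomputable def coeffMatrix {I J : Type*} (e : I → ℕ) (φ : J → ℂ[X]) : Matrix I J ℂ :=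
  Matrix.of fun i j => (φ j).coeff (e i)

/-- The matrix whose columns are the vectors `φ_j(W) v`. -/
noncomputable def evMatrix {κ J : Type*} [Fintype κ] [DecidableEq κ] (W : Matrix κ κ ℂ) (v : κ → ℂ)
    (φ : J → ℂ[X]) : Matrix κ J ℂ :=
  Matrix.of fun i j => (aeval W (φ j)).mulVec v i

/-- The Krylov matrix with columns `v, W v, …, W ^ (m - 1) v`. -/
noncomputable def krylov {κ : Type*} [Fintype κ] [DecidableEq κ] (W : Matrix κ κ ℂ) (v : κ → ℂ)
    (m : ℕ) : Matrix κ (Fin m) ℂ :=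
  evMatrix W v fun j : Fin m => X ^ (j : ℕ)

/-- The exponents `0, …, n + s - 1` in two blocks. -/
def expo₂ (n s : ℕ) : Fin n ⊕ Fin s → ℕ :=
  Sum.elim (fun i => i) (fun i => n + i)

/-- The exponents `0, …, r + n + s - 1` in three blocks. -/
def expo₃ (r n s : ℕ) : Fin r ⊕ (Fin n ⊕ Fin s) → ℕ :=
  Sum.elim (fun i => i) (fun i => r + expo₂ n s i)

theorem sum_expo₂ {M : Type*} [AddCommMonoid M] (n s : ℕ) (h : ℕ → M) :
    ∑ i, h (expo₂ n s i) = ∑ m ∈ Finset.range (n + s), h m := by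
  rw [Fintype.sum_sum_type, Finset.sum_range_add, Finset.sum_range, Finset.sum_range]
  rfl

theorem sum_expo₃ {M : Type*} [AddCommMonoid M] (r n s : ℕ) (h : ℕ → M) :
    ∑ i, h (expo₃ r n s i) = ∑ m ∈ Finset.range (r + (n + s)), h m := by
  rw [Fintype.sum_sum_type, Finset.sum_range_add, Finset.sum_range,
    ← sum_expo₂ n s (fun m => h (r + m))]
  rfl

theorem evMatrix_mul {κ J : Type*} [Fintype κ] [DecidableEq κ] (W : Matrix κ κ ℂ) (v : κ → ℂ)
    (p : ℂ[X]) (φ : J → ℂ[X]) :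
    evMatrix W v (fun j => p * φ j) = aeval W p * evMatrix W v φ := by
  ext i j
  simp only [evMatrix, Matrix.of_apply, map_mul, ← Matrix.mulVec_mulVec]
  rfl

/-- `φ_j(W) v` is linear in the coefficients of `φ_j`, so any factorization between coefficient
matrices passes to evaluations. The condition `he` says that `e` enumerates `0, …, N - 1`. -/
theorem evMatrix_mul_coeffMatrix {κ I J : Type*} [Fintype κ] [DecidableEq κ] [Fintype I]
    (W : Matrix κ κ ℂ) (v : κ → ℂ) (e : I → ℕ) (N : ℕ)
    (he : ∀ h : ℕ → ℂ, ∑ i, h (e i) = ∑ m ∈ Finset.range N, h m)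
    (φ : J → ℂ[X]) (hφ : ∀ j, (φ j).natDegree < N) :
    evMatrix W v (fun i => X ^ e i) * coeffMatrix e φ = evMatrix W v φ := by
  ext i j
  simp only [evMatrix, coeffMatrix, Matrix.mul_apply, Matrix.of_apply]
  rw [he (fun m => (aeval W (X ^ m : ℂ[X])).mulVec v i * (φ j).coeff m)]
  conv_rhs => rw [(φ j).as_sum_range' N (hφ j)]
  simp only [map_sum, Matrix.sum_mulVec, Finset.sum_apply]
  refine Finset.sum_congr rfl fun m _ => ?_
  rw [← C_mul_X_pow_eq_monomial, map_mul, aeval_C, ← Algebra.smul_def, Matrix.smul_mulVec,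
    Pi.smul_apply, smul_eq_mul, mul_comm]

/-! ### The Toeplitz determinant through a change of basis. -/

/-- The monomials of low and of high degree completing the columns `f X ^ j`. -/
noncomputable def toeplitzColumns (r n s : ℕ) (f : ℂ[X]) : Fin r ⊕ (Fin n ⊕ Fin s) → ℂ[X] :=
  Sum.elim (fun i => X ^ (i : ℕ))
    (Sum.elim (fun j => f * X ^ (j : ℕ)) (fun i => X ^ (n + r + (i : ℕ))))

/-- As `toeplitzColumns`, with multiples of the divisor `g` of `f` as the last columns. -/
noncomputable def divisorColumns (r n s : ℕ) (f g : ℂ[X]) : Fin r ⊕ (Fin n ⊕ Fin s) → ℂ[X] :=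
  Sum.elim (fun i => X ^ (i : ℕ))
    (Sum.elim (fun j => f * X ^ (j : ℕ)) (fun i => g * X ^ (n + (i : ℕ))))

theorem det_coeffMatrix_low (r n s : ℕ) (ψ : Fin n ⊕ Fin s → ℂ[X]) :
    (coeffMatrix (expo₃ r n s) (Sum.elim (fun i : Fin r => X ^ (i : ℕ)) ψ)).det =
      (coeffMatrix (fun i => r + expo₂ n s i) ψ).det := by
  have : coeffMatrix (expo₃ r n s) (Sum.elim (fun i : Fin r => X ^ (i : ℕ)) ψ) =
      Matrix.fromBlocks 1 (coeffMatrix (fun i : Fin r => (i : ℕ)) ψ) 0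
        (coeffMatrix (fun i => r + expo₂ n s i) ψ) := by
    ext i j
    rcases i with i | i <;> rcases j with j | j
    · simp [coeffMatrix, expo₃, coeff_X_pow, Matrix.one_apply, Fin.ext_iff]
    · simp [coeffMatrix, expo₃]
    · simp only [coeffMatrix, expo₃, coeff_X_pow, Matrix.of_apply, Sum.elim_inr, Sum.elim_inl,
        Matrix.fromBlocks_apply₂₁, Matrix.zero_apply]
      rw [if_neg (by omega)]
    · simp [coeffMatrix, expo₃]
  rw [this, Matrix.det_fromBlocks_zero₂₁, Matrix.det_one, one_mul]

theorem det_toeplitzColumns (r n s : ℕ) (f : ℂ[X]) :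
    (coeffMatrix (expo₃ r n s) (toeplitzColumns r n s f)).det =
      (coeffMatrix (fun i : Fin n => r + i) (fun j : Fin n => f * X ^ (j : ℕ))).det := by
  rw [toeplitzColumns, det_coeffMatrix_low]
  have : coeffMatrix (fun i => r + expo₂ n s i)
      (Sum.elim (fun j : Fin n => f * X ^ (j : ℕ)) (fun i : Fin s => X ^ (n + r + (i : ℕ)))) =
      Matrix.fromBlocks (coeffMatrix (fun i : Fin n => r + i) (fun j : Fin n => f * X ^ (j : ℕ))) 0
        (coeffMatrix (fun i : Fin s => r + (n + i)) (fun j : Fin n => f * X ^ (j : ℕ))) 1 := by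
    ext i j
    rcases i with i | i <;> rcases j with j | j
    · simp [coeffMatrix, expo₂]
    · simp only [coeffMatrix, expo₂, coeff_X_pow, Matrix.of_apply, Sum.elim_inr, Sum.elim_inl,
        Matrix.fromBlocks_apply₁₂, Matrix.zero_apply]
      rw [if_neg (by omega)]
    · simp [coeffMatrix, expo₂]
    · simp only [coeffMatrix, expo₂, coeff_X_pow, Matrix.of_apply, Sum.elim_inr,
        Matrix.fromBlocks_apply₂₂, Matrix.one_apply, Fin.ext_iff]
      congr 1
      exact propext ⟨fun h => by omega, fun h => by omega⟩
  rw [this, Matrix.det_fromBlocks_zero₁₂, Matrix.det_one, mul_one]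

theorem det_coeffMatrix_mul_monic {r n : ℕ} (g : ℂ[X]) (hg : g.Monic) (hr : g.natDegree = r)
    (m : ℕ) :
    (coeffMatrix (fun i : Fin n => r + (m + i)) (fun j : Fin n => g * X ^ (m + (j : ℕ)))).det
      = 1 := by
  rw [Matrix.det_of_isUpperTriangular]
  · refine Finset.prod_eq_one fun i _ => ?_
    simp only [coeffMatrix, Matrix.of_apply, coeff_mul_X_pow]
    rw [← hr]; exact hg
  · intro i j hij
    have hij : (j : ℕ) < i := hij
    simp only [coeffMatrix, Matrix.of_apply]
    rw [coeff_mul_X_pow', if_pos (by omega)]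
    exact coeff_eq_zero_of_natDegree_lt (by omega)

/-- Once the low monomials are split off, every remaining column is a multiple of `g`.
Multiplication by the monic `g`, read in the rows from `r` on, is unitriangular; the cofactors `G
X^j`, `X^(n+i)` form a triangular matrix with `n` diagonal entries `G(0)` and the rest `1`. -/
theorem det_divisorColumns (r n s : ℕ) (g G : ℂ[X]) (hg : g.Monic) (hr : g.natDegree = r)
    (hs : G.natDegree ≤ s) (hs0 : 0 < s) :
    (coeffMatrix (expo₃ r n s) (divisorColumns r n s (g * G) g)).det = G.coeff 0 ^ n := by
  rw [divisorColumns, det_coeffMatrix_low]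
  set φ : Fin n ⊕ Fin s → ℂ[X] :=
    Sum.elim (fun j : Fin n => G * X ^ (j : ℕ)) (fun i : Fin s => X ^ (n + (i : ℕ))) with hφ
  have hdeg : ∀ j, (φ j).natDegree < n + s := by
    rintro (j | j)
    · have := natDegree_mul_le (p := G) (q := X ^ (j : ℕ))
      rw [natDegree_X_pow] at this
      simp only [hφ, Sum.elim_inl]
      omega
    · simp only [hφ, Sum.elim_inr, natDegree_X_pow]
      omega
  have h1 : (Sum.elim (fun j : Fin n => g * G * X ^ (j : ℕ))
      (fun i : Fin s => g * X ^ (n + (i : ℕ)))) = fun j => g * φ j := by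
    ext j
    rcases j with j | j <;> simp [hφ, mul_assoc]
  have h2 : coeffMatrix (fun i => r + expo₂ n s i) (fun j => g * φ j) =
      coeffMatrix (fun i => r + expo₂ n s i) (fun j => g * X ^ expo₂ n s j) *
        coeffMatrix (expo₂ n s) φ := by
    ext i j
    simp only [coeffMatrix, Matrix.mul_apply, Matrix.of_apply]
    refine Eq.trans ?_
      (sum_expo₂ n s fun m => (g * X ^ m).coeff (r + expo₂ n s i) * (φ j).coeff m).symm
    conv_lhs => rw [(φ j).as_sum_range' _ (hdeg j)]
    simp only [Finset.mul_sum, finsetSum_coeff]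
    refine Finset.sum_congr rfl fun m _ => ?_
    rw [← C_mul_X_pow_eq_monomial, mul_left_comm, coeff_C_mul, mul_comm]
  have h3 : (coeffMatrix (fun i => r + expo₂ n s i) (fun j => g * X ^ expo₂ n s j)).det = 1 := by
    have : coeffMatrix (fun i => r + expo₂ n s i) (fun j => g * X ^ expo₂ n s j) =
        Matrix.fromBlocks
          (coeffMatrix (fun i : Fin n => r + (0 + i)) (fun j : Fin n => g * X ^ (0 + (j : ℕ))))
          (coeffMatrix (fun i : Fin n => r + i) (fun j : Fin s => g * X ^ (n + (j : ℕ)))) 0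
          (coeffMatrix (fun i : Fin s => r + (n + i)) (fun j : Fin s => g * X ^ (n + (j : ℕ)))) := by
      ext i j
      rcases i with i | i <;> rcases j with j | j
      · simp [coeffMatrix, expo₂]
      · simp [coeffMatrix, expo₂]
      · simp only [coeffMatrix, expo₂, Matrix.of_apply, Sum.elim_inr, Sum.elim_inl,
          Matrix.fromBlocks_apply₂₁, Matrix.zero_apply]
        rw [coeff_mul_X_pow', if_pos (by omega)]
        exact coeff_eq_zero_of_natDegree_lt (by omega)
      · simp [coeffMatrix, expo₂]
    rw [this, Matrix.det_fromBlocks_zero₂₁, det_coeffMatrix_mul_monic g hg hr,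
      det_coeffMatrix_mul_monic g hg hr, one_mul]
  have h4 : (coeffMatrix (expo₂ n s) φ).det = G.coeff 0 ^ n := by
    have : coeffMatrix (expo₂ n s) φ = Matrix.fromBlocks
        (coeffMatrix (fun i : Fin n => (i : ℕ)) (fun j : Fin n => G * X ^ (j : ℕ))) 0
        (coeffMatrix (fun i : Fin s => n + (i : ℕ)) (fun j : Fin n => G * X ^ (j : ℕ))) 1 := by
      ext i j
      rcases i with i | i <;> rcases j with j | j
      · simp [coeffMatrix, expo₂, hφ]
      · simp only [coeffMatrix, expo₂, hφ, coeff_X_pow, Matrix.of_apply, Sum.elim_inr,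
          Sum.elim_inl, Matrix.fromBlocks_apply₁₂, Matrix.zero_apply]
        rw [if_neg (by omega)]
      · simp [coeffMatrix, expo₂, hφ]
      · simp [coeffMatrix, expo₂, hφ, coeff_X_pow, Matrix.one_apply, Fin.ext_iff]
    rw [this, Matrix.det_fromBlocks_zero₁₂, Matrix.det_one, mul_one,
      Matrix.det_of_isLowerTriangular]
    · simp [coeffMatrix, coeff_mul_X_pow']
    · intro i j hij
      have hij : (i : ℕ) < j := hij
      simp only [coeffMatrix, Matrix.of_apply]
      rw [coeff_mul_X_pow', if_neg (by omega)]
  rw [h1, h2, Matrix.det_mul, h3, h4, one_mul]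

/-- The Toeplitz determinant of `g G` as a determinant of the fixed size `s = deg G`, together
with the relations that the matrices of the change of basis satisfy. -/
theorem exists_det_toeplitz_eq (r n s : ℕ) (g G : ℂ[X]) (hg : g.Monic) (hr : g.natDegree = r)
    (hs : G.natDegree ≤ s) (hs0 : 0 < s) (hG0 : G.coeff 0 ≠ 0) :
    ∃ (a : Matrix (Fin r) (Fin s) ℂ) (b : Matrix (Fin n) (Fin s) ℂ) (d : Matrix (Fin s) (Fin s) ℂ),
      (coeffMatrix (fun i : Fin n => r + i) (fun j : Fin n => g * G * X ^ (j : ℕ))).det =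
        G.coeff 0 ^ n * d.det ∧
      ∀ (t : ℕ) (W : Matrix (Fin t) (Fin t) ℂ) (v : Fin t → ℂ),
        W ^ (n + r) * krylov W v s = krylov W v r * a +
          aeval W (g * G) * krylov W v n * b + aeval W g * W ^ n * krylov W v s * d := by
  set A := coeffMatrix (expo₃ r n s) (toeplitzColumns r n s (g * G)) with hA
  set D := coeffMatrix (expo₃ r n s) (divisorColumns r n s (g * G) g) with hD
  have hDdet : D.det = G.coeff 0 ^ n := det_divisorColumns r n s g G hg hr hs hs0
  have hDu : IsUnit D.det := by
    rw [hDdet]; exact (pow_ne_zero _ hG0).isUnit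
  set Q := D⁻¹ * A with hQ
  have hAQ : A = D * Q := by rw [hQ, Matrix.mul_nonsing_inv_cancel_left _ _ hDu]
  -- A column shared by `A` and `D` becomes a column of the identity in `D⁻¹ A`; only the last `s`
  -- columns of `Q` carry information.
  have hcol : ∀ j, (∀ i, A i j = D i j) → ∀ i, Q i j = (1 : Matrix _ _ ℂ) i j := by
    intro j h i
    rw [← Matrix.nonsing_inv_mul D hDu, hQ, Matrix.mul_apply, Matrix.mul_apply]
    exact Finset.sum_congr rfl fun l _ => by rw [h l]
  have hl : ∀ i j, Q i (Sum.inl j) = (1 : Matrix _ _ ℂ) i (Sum.inl j) := fun i j =>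
    hcol _ (fun _ => rfl) i
  have hm : ∀ i j, Q i (Sum.inr (Sum.inl j)) = (1 : Matrix _ _ ℂ) i (Sum.inr (Sum.inl j)) :=
    fun i j => hcol _ (fun _ => rfl) i
  refine ⟨Matrix.of fun i j => Q (Sum.inl i) (Sum.inr (Sum.inr j)),
    Matrix.of fun i j => Q (Sum.inr (Sum.inl i)) (Sum.inr (Sum.inr j)),
    Matrix.of fun i j => Q (Sum.inr (Sum.inr i)) (Sum.inr (Sum.inr j)), ?_, ?_⟩
  · rw [← det_toeplitzColumns r n s, ← hA, hAQ, Matrix.det_mul, hDdet]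
    congr 1
    have hQ1 : Q = Matrix.fromBlocks 1 (Matrix.of fun i j => Q (Sum.inl i) (Sum.inr j)) 0
        (Matrix.of fun i j => Q (Sum.inr i) (Sum.inr j)) := by
      ext i j
      rcases i with i | i <;> rcases j with j | j
      · simp [hl, Matrix.one_apply]
      · simp
      · simp [hl]
      · simp
    have hQ2 : (Matrix.of fun i j => Q (Sum.inr i) (Sum.inr j)) = Matrix.fromBlocks 1
        (Matrix.of fun i j => Q (Sum.inr (Sum.inl i)) (Sum.inr (Sum.inr j))) 0
        (Matrix.of fun i j => Q (Sum.inr (Sum.inr i)) (Sum.inr (Sum.inr j))) := by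
      ext i j
      rcases i with i | i <;> rcases j with j | j
      · simp [hm, Matrix.one_apply]
      · simp
      · simp [hm]
      · simp
    conv_lhs => rw [hQ1]
    rw [Matrix.det_fromBlocks_zero₂₁, Matrix.det_one, one_mul]
    conv_lhs => rw [hQ2]
    rw [Matrix.det_fromBlocks_zero₂₁, Matrix.det_one, one_mul]
  · intro t W v
    have hgG : (g * G).natDegree ≤ r + s := natDegree_mul_le.trans (by omega)
    have hfj : ∀ j : Fin n, (g * G * X ^ (j : ℕ)).natDegree < r + (n + s) := by
      intro j
      have := natDegree_mul_le (p := g * G) (q := X ^ (j : ℕ))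
      rw [natDegree_X_pow] at this
      omega
    have e1 := evMatrix_mul_coeffMatrix W v (expo₃ r n s) _ (sum_expo₃ r n s)
      (toeplitzColumns r n s (g * G)) (by
        rintro (j | j | j)
        · simp only [toeplitzColumns, Sum.elim_inl, natDegree_X_pow]; omega
        · exact hfj j
        · simp only [toeplitzColumns, Sum.elim_inr, natDegree_X_pow]; omega)
    have e2 := evMatrix_mul_coeffMatrix W v (expo₃ r n s) _ (sum_expo₃ r n s)
      (divisorColumns r n s (g * G) g) (by
        rintro (j | j | j)
        · simp only [divisorColumns, Sum.elim_inl, natDegree_X_pow]; omega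
        · exact hfj j
        · have := natDegree_mul_le (p := g) (q := X ^ (n + (j : ℕ)))
          rw [natDegree_X_pow] at this
          simp only [divisorColumns, Sum.elim_inr]; omega)
    have e3 : evMatrix W v (toeplitzColumns r n s (g * G)) =
        evMatrix W v (divisorColumns r n s (g * G) g) * Q := by
      rw [← e1, ← e2, Matrix.mul_assoc, ← hAQ]
    have k1 : W ^ (n + r) * krylov W v s =
        evMatrix W v (fun j : Fin s => X ^ (n + r + (j : ℕ))) := by
      simp only [pow_add X (n + r)]
      rw [evMatrix_mul, map_pow, aeval_X]; rfl
    have k2 : aeval W (g * G) * krylov W v n =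
        evMatrix W v (fun j : Fin n => g * G * X ^ (j : ℕ)) := (evMatrix_mul _ _ _ _).symm
    have k3 : aeval W g * W ^ n * krylov W v s =
        evMatrix W v (fun j : Fin s => g * X ^ (n + (j : ℕ))) := by
      simp only [pow_add X n, ← mul_assoc]
      rw [evMatrix_mul, map_mul, map_pow, aeval_X]; rfl
    rw [k1, k2, k3]
    ext i j
    have := congrFun (congrFun e3 i) (Sum.inr (Sum.inr j))
    rw [Matrix.mul_apply, Fintype.sum_sum_type, Fintype.sum_sum_type, ← add_assoc] at this
    rw [Matrix.add_apply, Matrix.add_apply, Matrix.mul_apply, Matrix.mul_apply, Matrix.mul_apply]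
    exact this

/-- The Toeplitz determinant of `g G` in terms of annihilating matrices of `g` and `G`. -/
theorem det_toeplitz_mul (r n s : ℕ) (g G : ℂ[X]) (hg : g.Monic) (hr : g.natDegree = r)
    (hs : G.natDegree ≤ s) (hs0 : 0 < s) (hG0 : G.coeff 0 ≠ 0)
    (A : Matrix (Fin r) (Fin r) ℂ) (u : Fin r → ℂ) (Y : Matrix (Fin s) (Fin s) ℂ) (v : Fin s → ℂ)
    (hA : aeval A g = 0) (hY : aeval Y G = 0) (hYu : IsUnit Y.det)
    (hAk : IsUnit (krylov A u r).det) (hYk : IsUnit (krylov Y v s).det) :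
    (coeffMatrix (fun i : Fin n => r + i) (fun j : Fin n => g * G * X ^ (j : ℕ))).det *
        (aeval Y g).det = G.coeff 0 ^ n * Y.det ^ r *
      (1 - (krylov Y v s)⁻¹ * (Y⁻¹) ^ (n + r) * krylov Y v r * (krylov A u r)⁻¹ *
        A ^ (n + r) * krylov A u s).det := by
  obtain ⟨a, b, d, hdet, h⟩ := exists_det_toeplitz_eq r n s g G hg hr hs hs0 hG0
  have h1 := h r A u
  have h2 := h s Y v
  -- At `A` both terms containing `g` vanish, which isolates `a`; at `Y` only the term containing
  -- `G` vanishes, which leaves `d` in terms of `a`.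
  rw [map_mul, hA] at h1
  rw [map_mul, hY] at h2
  simp only [zero_mul, mul_zero, Matrix.zero_mul, add_zero] at h1 h2
  have ha : a = (krylov A u r)⁻¹ * (A ^ (n + r) * krylov A u s) := by
    rw [h1, Matrix.nonsing_inv_mul_cancel_left _ _ hAk]
  set E := (krylov Y v s)⁻¹ * (Y⁻¹) ^ (n + r) * krylov Y v r * (krylov A u r)⁻¹ *
        A ^ (n + r) * krylov A u s with hE
  have hYp : IsUnit (Y ^ (n + r)).det := by rw [Matrix.det_pow]; exact hYu.pow _
  have h3 : Y ^ (n + r) * krylov Y v s * E = krylov Y v r * a := by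
    rw [hE, ha]
    simp only [Matrix.mul_assoc]
    rw [Matrix.mul_nonsing_inv_cancel_left _ _ hYk, Matrix.inv_pow',
      Matrix.mul_nonsing_inv_cancel_left _ _ hYp]
  have h4 : aeval Y g * Y ^ n * krylov Y v s * d = Y ^ (n + r) * krylov Y v s * (1 - E) := by
    rw [mul_sub, h3, mul_one, h2, add_sub_cancel_left]
  have h5 := congrArg Matrix.det h4
  simp only [Matrix.det_mul, Matrix.det_pow] at h5
  have h6 : (aeval Y g).det * d.det = Y.det ^ r * (1 - E).det := by
    have hc : Y.det ^ n * (krylov Y v s).det ≠ 0 :=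
      mul_ne_zero (pow_ne_zero _ hYu.ne_zero) hYk.ne_zero
    apply mul_left_cancel₀ hc
    rw [pow_add] at h5
    linear_combination h5
  rw [hdet]
  linear_combination G.coeff 0 ^ n * h6

/-! ### Cyclic matrices with prescribed, possibly repeated, eigenvalues. -/

section Bidiagonal

/-- The matrix with diagonal `x` and all subdiagonal entries equal to `ε`. -/
noncomputable def bidiagonal {r : ℕ} (ε : ℂ) (x : Fin r → ℂ) : Matrix (Fin r) (Fin r) ℂ :=
  Matrix.diagonal x + Matrix.of fun i j : Fin r => if (i : ℕ) = j + 1 then ε else 0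

/-- The first vector of the standard basis. -/
noncomputable def firstVec (r : ℕ) : Fin r → ℂ := fun i => if (i : ℕ) = 0 then 1 else 0

theorem bidiagonal_isLowerTriangular {r : ℕ} (ε : ℂ) (x : Fin r → ℂ) :
    (bidiagonal ε x).IsLowerTriangular := by
  intro i j hij
  have hij : (i : ℕ) < j := hij
  have h1 : i ≠ j := fun h => by rw [h] at hij; exact lt_irrefl _ hij
  simp only [bidiagonal, Matrix.add_apply, Matrix.diagonal_apply_ne _ h1, Matrix.of_apply]
  rw [if_neg (by omega), add_zero]

theorem bidiagonal_apply_self {r : ℕ} (ε : ℂ) (x : Fin r → ℂ) (i : Fin r) :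
    bidiagonal ε x i i = x i := by
  simp [bidiagonal]

theorem det_bidiagonal {r : ℕ} (ε : ℂ) (x : Fin r → ℂ) : (bidiagonal ε x).det = ∏ i, x i := by
  rw [Matrix.det_of_isLowerTriangular _ (bidiagonal_isLowerTriangular ε x)]
  simp [bidiagonal_apply_self]

theorem aeval_bidiagonal {r : ℕ} (ε : ℂ) (x : Fin r → ℂ) :
    aeval (bidiagonal ε x) (∏ i, (X - C (x i))) = 0 := by
  have h : (bidiagonal ε x).charpoly = ∏ i, (X - C (x i)) := by
    rw [← Matrix.charpoly_transpose, Matrix.charpoly_of_isUpperTriangular]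
    · simp [bidiagonal_apply_self]
    · exact fun i j hij => bidiagonal_isLowerTriangular ε x hij
  rw [← h, Matrix.aeval_self_charpoly]

/-- The determinant is multiplicative over the factors of the polynomial, and each factor is again
bidiagonal, with shifted diagonal. -/
theorem det_aeval_bidiagonal {r s : ℕ} (ε : ℂ) (y : Fin s → ℂ) (x : Fin r → ℂ) :
    (aeval (bidiagonal ε y) (∏ i, (X - C (x i)))).det = ∏ i, ∏ j, (y j - x i) := by
  have h := map_prod (Matrix.detMonoidHom.comp
    (aeval (bidiagonal ε y) : ℂ[X] →ₐ[ℂ] _).toMonoidHom) (fun i => X - C (x i)) Finset.univ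
  refine h.trans (Finset.prod_congr rfl fun i _ => ?_)
  have h1 : (aeval (bidiagonal ε y)) (X - C (x i)) = bidiagonal ε (fun j => y j - x i) := by
    rw [map_sub, aeval_X, aeval_C, Matrix.algebraMap_eq_diagonal]
    simp only [bidiagonal]
    rw [add_sub_right_comm, Matrix.diagonal_sub]
    rfl
  change ((aeval (bidiagonal ε y)) (X - C (x i))).det = _
  rw [h1, det_bidiagonal]

theorem krylov_eq {κ : Type*} [Fintype κ] [DecidableEq κ] (W : Matrix κ κ ℂ) (v : κ → ℂ) (m : ℕ) :
    krylov W v m = Matrix.of fun i (j : Fin m) => (W ^ (j : ℕ)).mulVec v i := by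
  ext i j
  simp [krylov, evMatrix]

theorem bidiagonal_mulVec {r : ℕ} (ε : ℂ) (x u : Fin r → ℂ) (i : Fin r) :
    (bidiagonal ε x).mulVec u i = x i * u i +
      if h : 0 < (i : ℕ) then ε * u ⟨i - 1, by omega⟩ else 0 := by
  rw [bidiagonal, Matrix.add_mulVec, Pi.add_apply, Matrix.mulVec_diagonal]
  congr 1
  simp only [Matrix.mulVec, dotProduct, Matrix.of_apply, ite_mul, zero_mul]
  split_ifs with h
  · rw [Finset.sum_eq_single ⟨i - 1, by omega⟩]
    · rw [if_pos (by simp; omega)]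
    · intro j _ hj
      rw [if_neg]
      intro h'
      apply hj
      ext
      simp; omega
    · simp
  · exact Finset.sum_eq_zero fun j _ => if_neg (by omega)

theorem bidiagonal_pow_mulVec {r : ℕ} (ε : ℂ) (x : Fin r → ℂ) (m : ℕ) :
    ∀ i : Fin r, (m < (i : ℕ) → ((bidiagonal ε x) ^ m).mulVec (firstVec r) i = 0) ∧
      ((i : ℕ) = m → ((bidiagonal ε x) ^ m).mulVec (firstVec r) i = ε ^ m) := by
  induction m with
  | zero =>
    intro i
    simp only [pow_zero, Matrix.one_mulVec, firstVec]
    exact ⟨fun h => if_neg (by omega), fun h => if_pos h⟩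
  | succ m ih =>
    intro i
    rw [pow_succ', ← Matrix.mulVec_mulVec, bidiagonal_mulVec]
    constructor
    · intro h
      rw [(ih i).1 (by omega), dif_pos (by omega), (ih _).1 (by simp; omega)]
      simp
    · intro h
      rw [(ih i).1 (by omega), dif_pos (by omega), (ih _).2 (by simp; omega)]
      ring

/-- Each application of the matrix pushes the first basis vector one coordinate further with factor
`ε`, so the Krylov matrix is triangular with diagonal `ε^i`. Coincident `x_i` do no harm. -/
theorem det_krylov_bidiagonal {r : ℕ} {ε : ℂ} (hε : ε ≠ 0) (x : Fin r → ℂ) :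
    IsUnit (krylov (bidiagonal ε x) (firstVec r) r).det := by
  rw [krylov_eq, Matrix.det_of_isUpperTriangular]
  · refine (Finset.prod_ne_zero_iff.mpr fun i _ => ?_).isUnit
    rw [Matrix.of_apply, (bidiagonal_pow_mulVec ε x i i).2 rfl]
    exact pow_ne_zero _ hε
  · intro i j hij
    exact (bidiagonal_pow_mulVec ε x j i).1 hij

theorem continuous_bidiagonal {r : ℕ} (ε : ℂ) :
    Continuous (bidiagonal ε : (Fin r → ℂ) → Matrix (Fin r) (Fin r) ℂ) := by
  unfold bidiagonal
  exact (continuous_id.matrix_diagonal).add continuous_const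

theorem continuous_krylov_bidiagonal {r : ℕ} (ε : ℂ) (m : ℕ) :
    Continuous fun x : Fin r → ℂ => krylov (bidiagonal ε x) (firstVec r) m := by
  simp only [krylov_eq]
  refine continuous_matrix fun i j => ?_
  exact (continuous_apply i).comp
    (((continuous_bidiagonal ε).pow _).matrix_mulVec continuous_const)

theorem _root_.ContinuousOn.matrix_inv {α n : Type*} [TopologicalSpace α] [Fintype n]
    [DecidableEq n] {M : α → Matrix n n ℂ} {S : Set α} (hM : ContinuousOn M S)
    (h : ∀ a ∈ S, (M a).det ≠ 0) : ContinuousOn (fun a => (M a)⁻¹) S := by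
  simp only [Matrix.inv_def, Ring.inverse_eq_inv']
  exact ((continuous_id.matrix_det.comp_continuousOn hM).inv₀ h).smul
    (continuous_id.matrix_adjugate.comp_continuousOn hM)

end Bidiagonal

/-! ### Norm estimates and the uniform asymptotics. -/

section Norms

attribute [local instance] Matrix.linftyOpNormedAddCommGroup Matrix.linftyOpNormedSpace
  Matrix.linftyOpNormedRing

theorem norm_subdiagonal_le {r : ℕ} (ε : ℂ) :
    ‖(Matrix.of fun i j : Fin r => if (i : ℕ) = j + 1 then ε else 0)‖ ≤ ‖ε‖ := by
  rw [Matrix.linfty_opNorm_def, ← coe_nnnorm, NNReal.coe_le_coe]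
  refine Finset.sup_le fun i _ => ?_
  simp only [Matrix.of_apply]
  by_cases hi : 0 < (i : ℕ)
  · rw [Finset.sum_eq_single ⟨i - 1, by omega⟩]
    · split_ifs <;> simp
    · intro j _ hj
      rw [if_neg, nnnorm_zero]
      intro h'
      apply hj
      ext
      simp; omega
    · simp
  · rw [Finset.sum_eq_zero]
    · simp
    · intro j _
      rw [if_neg (by omega), nnnorm_zero]

theorem norm_bidiagonal_le {r : ℕ} (ε : ℂ) (x : Fin r → ℂ) {M : ℝ} (hM : 0 ≤ M)
    (hx : ∀ i, ‖x i‖ ≤ M) : ‖bidiagonal ε x‖ ≤ M + ‖ε‖ := by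
  refine (norm_add_le _ _).trans (add_le_add ?_ (norm_subdiagonal_le ε))
  rw [Matrix.linfty_opNorm_diagonal]
  exact (pi_norm_le_iff_of_nonneg hM).mpr hx

/-- With `D` the inverse of the diagonal part and `L` the subdiagonal part, the inverse satisfies `V
= D - D L V`; taking norms and solving for `‖V‖` gives the bound. -/
theorem norm_bidiagonal_inv_le {s : ℕ} (ε : ℂ) (y : Fin s → ℂ) {M : ℝ} (hM : ‖ε‖ < M)
    (hy : ∀ j, M ≤ ‖y j‖) : ‖(bidiagonal ε y)⁻¹‖ ≤ (M - ‖ε‖)⁻¹ := by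
  have hM0 : 0 < M := (norm_nonneg ε).trans_lt hM
  have hy0 : ∀ j, y j ≠ 0 := fun j => norm_pos_iff.mp (hM0.trans_le (hy j))
  have hu : IsUnit (bidiagonal ε y).det := by
    rw [det_bidiagonal]
    exact (Finset.prod_ne_zero_iff.mpr fun j _ => hy0 j).isUnit
  set L : Matrix (Fin s) (Fin s) ℂ := Matrix.of fun i j : Fin s => if (i : ℕ) = j + 1 then ε else 0
    with hL
  set V := (bidiagonal ε y)⁻¹ with hV
  set D : Matrix (Fin s) (Fin s) ℂ := Matrix.diagonal fun j => (y j)⁻¹ with hD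
  have h1 : D * bidiagonal ε y = 1 + D * L := by
    rw [bidiagonal, mul_add, hD, Matrix.diagonal_mul_diagonal]
    congr 1
    rw [← Matrix.diagonal_one]
    congr 1
    ext j
    exact inv_mul_cancel₀ (hy0 j)
  have h2 : V = D - D * L * V := by
    have := congrArg (· * V) h1
    simp only [add_mul, one_mul] at this
    rw [mul_assoc, hV, Matrix.mul_nonsing_inv _ hu, mul_one] at this
    rw [hV]
    exact eq_sub_of_add_eq this.symm
  have hDn : ‖D‖ ≤ M⁻¹ := by
    rw [hD, Matrix.linfty_opNorm_diagonal]
    refine (pi_norm_le_iff_of_nonneg (inv_nonneg.mpr hM0.le)).mpr fun j => ?_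
    rw [norm_inv]
    exact inv_anti₀ hM0 (hy j)
  have h3 : ‖V‖ ≤ M⁻¹ + M⁻¹ * ‖ε‖ * ‖V‖ := by
    conv_lhs => rw [h2]
    refine (norm_sub_le _ _).trans (add_le_add hDn ?_)
    refine (Matrix.linfty_opNorm_mul _ _).trans
      (mul_le_mul_of_nonneg_right ?_ (norm_nonneg _))
    exact (Matrix.linfty_opNorm_mul _ _).trans
      (mul_le_mul hDn (norm_subdiagonal_le ε) (norm_nonneg _) (inv_nonneg.mpr hM0.le))
  rw [← one_div, le_div_iff₀ (sub_pos.mpr hM)]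
  have h4 := mul_le_mul_of_nonneg_left h3 hM0.le
  have h5 : M * (M⁻¹ + M⁻¹ * ‖ε‖ * ‖V‖) = 1 + ‖ε‖ * ‖V‖ := by
    field_simp
  rw [h5] at h4
  linarith

/-- The determinant is a polynomial in the entries, hence differentiable at the identity. -/
theorem exists_norm_det_one_sub_le (s : ℕ) : ∃ C ρ : ℝ, 0 < ρ ∧ ∀ E : Matrix (Fin s) (Fin s) ℂ,
    ‖E‖ ≤ ρ → ‖(1 - E).det - 1‖ ≤ C * ‖E‖ := by
  have hd : DifferentiableAt ℂ (fun E : Matrix (Fin s) (Fin s) ℂ => (1 - E).det) 0 := by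
    simp only [Matrix.det_apply]
    refine DifferentiableAt.fun_sum fun σ _ => DifferentiableAt.const_smul ?_ _
    have h : ∀ i ∈ Finset.univ,
        DifferentiableAt ℂ (fun E : Matrix (Fin s) (Fin s) ℂ => (1 - E) (σ i) i) 0 := by
      intro i _
      simp only [Matrix.sub_apply]
      refine DifferentiableAt.const_sub ?_ _
      exact (LinearMap.toContinuousLinearMap
        (Matrix.entryLinearMap ℂ ℂ (σ i) i)).differentiableAt
    exact (HasFDerivAt.finsetProd fun i hi => (h i hi).hasFDerivAt).differentiableAt
  obtain ⟨C, hC⟩ := hd.isBigO_sub.bound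
  obtain ⟨ρ, hρ, h⟩ := Metric.eventually_nhds_iff.mp hC
  refine ⟨C, ρ / 2, by linarith, fun E hE => ?_⟩
  have := @h E (by rw [dist_zero_right]; linarith)
  simpa using this

theorem exists_bound_of_continuousOn_matrix {α : Type*} [TopologicalSpace α] {m n : Type*}
    [Fintype m] [Fintype n] {S : Set α} (hS : IsCompact S) {f : α → Matrix m n ℂ}
    (hf : ContinuousOn f S) : ∃ B, 0 ≤ B ∧ ∀ a ∈ S, ‖f a‖ ≤ B := by
  obtain ⟨B, hB⟩ := hS.exists_bound_of_continuousOn hf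
  exact ⟨max B 0, le_max_right _ _, fun a ha => (hB a ha).trans (le_max_left _ _)⟩

/-- Szegő asymptotics with exponential error for the Toeplitz determinants of
`∏ (X - x_i) ∏ (X - y_j)`, uniformly on a compact set on which the `x_i` are uniformly smaller
than the `y_j`. -/
theorem exists_det_toeplitz_asymptotics (r s : ℕ) (hs : 0 < s)
    (S : Set ((Fin r → ℂ) × (Fin s → ℂ))) (hS : IsCompact S) (δ m : ℝ) (hδ0 : 0 ≤ δ) (hδ : δ < 1)
    (hm : 0 < m) (h1 : ∀ σ ∈ S, ∀ i j, ‖σ.1 i‖ ≤ δ * ‖σ.2 j‖) (h2 : ∀ σ ∈ S, ∀ j, m ≤ ‖σ.2 j‖) :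
    ∃ c : ℝ, 0 < c ∧ ∃ (B : ℝ) (N : ℕ), ∀ n : ℕ, N ≤ n → ∀ σ ∈ S, ∃ R : ℂ,
      (coeffMatrix (fun i : Fin n => r + i) (fun j : Fin n =>
          (∏ i, (X - C (σ.1 i))) * (∏ i, (X - C (σ.2 i))) * X ^ (j : ℕ))).det *
          (∏ i, ∏ j, (σ.2 j - σ.1 i)) =
        ((-1) ^ s * ∏ j, σ.2 j) ^ n * (∏ j, σ.2 j) ^ r * (1 + R) ∧
      ‖R‖ ≤ B * Real.exp (-c * n) := by
  -- This choice makes `δ + 2 η < 1`, which is equivalent to `θ < 1` below.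
  set η : ℝ := (1 - δ) / 4 with hη
  have hη0 : 0 < η := by rw [hη]; linarith
  have hη1 : η < 1 := by rw [hη]; linarith
  set ε : ℂ := ((η * m : ℝ) : ℂ) with hε
  have hεn : ‖ε‖ = η * m := by
    rw [hε, Complex.norm_real, Real.norm_of_nonneg (by positivity)]
  have hε0 : ε ≠ 0 := norm_pos_iff.mp (by rw [hεn]; positivity)
  set θ : ℝ := (1 - η)⁻¹ * (δ + η) with hθ
  have hθ0 : 0 < θ := mul_pos (inv_pos.mpr (by linarith)) (by linarith)
  have hθ1 : θ < 1 := by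
    rw [hθ, inv_mul_lt_one₀ (by linarith), hη]; linarith
  have hy0 : ∀ σ ∈ S, ∀ j, σ.2 j ≠ 0 := fun σ hσ j => norm_pos_iff.mp (hm.trans_le (h2 σ hσ j))
  obtain ⟨B₁, hB₁0, hB₁⟩ := exists_bound_of_continuousOn_matrix hS
    (f := fun σ => (krylov (bidiagonal ε σ.2) (firstVec s) s)⁻¹)
    (ContinuousOn.matrix_inv
      ((continuous_krylov_bidiagonal ε s).comp continuous_snd).continuousOn
      fun σ _ => (det_krylov_bidiagonal hε0 σ.2).ne_zero)
  obtain ⟨B₂, hB₂0, hB₂⟩ := exists_bound_of_continuousOn_matrix hS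
    (f := fun σ => krylov (bidiagonal ε σ.2) (firstVec s) r)
    ((continuous_krylov_bidiagonal ε r).comp continuous_snd).continuousOn
  obtain ⟨B₃, hB₃0, hB₃⟩ := exists_bound_of_continuousOn_matrix hS
    (f := fun σ => (krylov (bidiagonal ε σ.1) (firstVec r) r)⁻¹)
    (ContinuousOn.matrix_inv
      ((continuous_krylov_bidiagonal ε r).comp continuous_fst).continuousOn
      fun σ _ => (det_krylov_bidiagonal hε0 σ.1).ne_zero)
  obtain ⟨B₄, hB₄0, hB₄⟩ := exists_bound_of_continuousOn_matrix hS
    (f := fun σ => krylov (bidiagonal ε σ.1) (firstVec r) s)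
    ((continuous_krylov_bidiagonal ε s).comp continuous_fst).continuousOn
  obtain ⟨C₀, ρ, hρ, hC₀⟩ := exists_norm_det_one_sub_le s
  set B₅ : ℝ := B₁ * B₂ * B₃ * B₄ with hB₅
  have hB₅0 : 0 ≤ B₅ := by positivity
  have hlim : Filter.Tendsto (fun n : ℕ => B₅ * θ ^ n) Filter.atTop (nhds 0) := by
    simpa using (tendsto_pow_atTop_nhds_zero_of_lt_one hθ0.le hθ1).const_mul B₅
  obtain ⟨N, hN⟩ := Filter.eventually_atTop.mp (hlim.eventually_le_const hρ)
  -- The rate is chosen so that `exp (-c) = θ`. The bound `1 ≤ n` keeps the exponent `n + r`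
  -- positive even for `r = 0`, where the empty identity matrix has norm `0`.
  refine ⟨-Real.log θ, neg_pos.mpr (Real.log_neg hθ0 hθ1), |C₀| * B₅, max N 1,
    fun n hn σ hσ => ?_⟩
  have hn1 : 0 < n + r := by have := le_trans (le_max_right N 1) hn; omega
  have hnN : N ≤ n := le_trans (le_max_left N 1) hn
  set A := bidiagonal ε σ.1 with hA
  set Y := bidiagonal ε σ.2 with hY
  set E := (krylov Y (firstVec s) s)⁻¹ * (Y⁻¹) ^ (n + r) * krylov Y (firstVec s) r *
    (krylov A (firstVec r) r)⁻¹ * A ^ (n + r) * krylov A (firstVec r) s with hE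
  have hYdet : Y.det = ∏ j, σ.2 j := det_bidiagonal _ _
  have hprod0 : ∏ j, σ.2 j ≠ 0 := Finset.prod_ne_zero_iff.mpr fun j _ => hy0 σ hσ j
  have hG0 : (∏ j, (X - C (σ.2 j))).coeff 0 = (-1) ^ s * ∏ j, σ.2 j := by
    rw [coeff_zero_eq_eval_zero, eval_prod]
    simp [Finset.prod_neg]
  have key := det_toeplitz_mul r n s (∏ i, (X - C (σ.1 i))) (∏ j, (X - C (σ.2 j)))
    (monic_prod_X_sub_C _ _) (by simp) (by simp) hs
    (by rw [hG0]; exact mul_ne_zero (pow_ne_zero _ (by norm_num)) hprod0)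
    A (firstVec r) Y (firstVec s) (aeval_bidiagonal _ _) (aeval_bidiagonal _ _)
    (by rw [hYdet]; exact hprod0.isUnit) (det_krylov_bidiagonal hε0 _)
    (det_krylov_bidiagonal hε0 _)
  rw [det_aeval_bidiagonal, hG0, hYdet, ← hE] at key
  refine ⟨(1 - E).det - 1, by rw [key, add_sub_cancel], ?_⟩
  have hAY : ‖Y⁻¹‖ * ‖A‖ ≤ θ := by
    have : Nonempty (Fin s) := ⟨⟨0, hs⟩⟩
    -- Both norms are compared with the least `‖y_j‖`, which cancels in the product.
    obtain ⟨j, hj⟩ := Finite.exists_min fun j => ‖σ.2 j‖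
    have hmj := h2 σ hσ j
    have hM0 : 0 < ‖σ.2 j‖ := hm.trans_le hmj
    have hηm : η * m ≤ η * ‖σ.2 j‖ := mul_le_mul_of_nonneg_left hmj hη0.le
    have hηM : η * ‖σ.2 j‖ < ‖σ.2 j‖ := by nlinarith
    have e1 := norm_bidiagonal_inv_le ε σ.2 (M := ‖σ.2 j‖) (by rw [hεn]; linarith) hj
    have e2 := norm_bidiagonal_le ε σ.1 (M := δ * ‖σ.2 j‖) (by positivity)
      (fun i => h1 σ hσ i j)
    rw [hεn] at e1 e2
    have e3 : ‖Y⁻¹‖ ≤ ((1 - η) * ‖σ.2 j‖)⁻¹ :=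
      e1.trans (inv_anti₀ (mul_pos (by linarith) hM0) (by linarith))
    have e4 : ‖A‖ ≤ (δ + η) * ‖σ.2 j‖ := e2.trans (by linarith)
    refine (mul_le_mul e3 e4 (norm_nonneg _)
      (inv_nonneg.mpr (mul_nonneg (by linarith) hM0.le))).trans_eq ?_
    rw [hθ, mul_inv]
    field_simp
  have hEn : ‖E‖ ≤ B₅ * θ ^ n := by
    have e1 : ‖E‖ ≤ ‖(krylov Y (firstVec s) s)⁻¹‖ * ‖Y⁻¹ ^ (n + r)‖ *
        ‖krylov Y (firstVec s) r‖ * ‖(krylov A (firstVec r) r)⁻¹‖ * ‖A ^ (n + r)‖ *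
        ‖krylov A (firstVec r) s‖ := by
      rw [hE]
      iterate 4
        refine (Matrix.linfty_opNorm_mul _ _).trans
          (mul_le_mul_of_nonneg_right ?_ (norm_nonneg _))
      exact Matrix.linfty_opNorm_mul _ _
    have e2 : ‖Y⁻¹ ^ (n + r)‖ * ‖A ^ (n + r)‖ ≤ θ ^ n := by
      calc ‖Y⁻¹ ^ (n + r)‖ * ‖A ^ (n + r)‖ ≤ ‖Y⁻¹‖ ^ (n + r) * ‖A‖ ^ (n + r) :=
            mul_le_mul (norm_pow_le' _ hn1) (norm_pow_le' _ hn1) (norm_nonneg _) (by positivity)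
        _ = (‖Y⁻¹‖ * ‖A‖) ^ (n + r) := (mul_pow _ _ _).symm
        _ ≤ θ ^ (n + r) := pow_le_pow_left₀ (by positivity) hAY _
        _ ≤ θ ^ n := pow_le_pow_of_le_one hθ0.le hθ1.le (by omega)
    have e3 : ‖(krylov Y (firstVec s) s)⁻¹‖ * ‖krylov Y (firstVec s) r‖ *
        ‖(krylov A (firstVec r) r)⁻¹‖ * ‖krylov A (firstVec r) s‖ ≤ B₅ := by
      rw [hB₅]
      have := hB₁ σ hσ
      have := hB₂ σ hσ
      have := hB₃ σ hσ
      have := hB₄ σ hσ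
      gcongr
    calc ‖E‖ ≤ _ := e1
      _ = (‖(krylov Y (firstVec s) s)⁻¹‖ * ‖krylov Y (firstVec s) r‖ *
        ‖(krylov A (firstVec r) r)⁻¹‖ * ‖krylov A (firstVec r) s‖) *
        (‖Y⁻¹ ^ (n + r)‖ * ‖A ^ (n + r)‖) := by ring
      _ ≤ B₅ * θ ^ n := mul_le_mul e3 e2 (by positivity) hB₅0
  have hexp : Real.exp (-(-Real.log θ) * n) = θ ^ n := by
    rw [neg_neg, mul_comm, Real.exp_nat_mul, Real.exp_log hθ0]
  rw [hexp]
  calc ‖(1 - E).det - 1‖ ≤ C₀ * ‖E‖ := hC₀ E (hEn.trans (hN n hnN))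
    _ ≤ |C₀| * (B₅ * θ ^ n) := mul_le_mul (le_abs_self _) hEn (norm_nonneg _) (abs_nonneg _)
    _ = |C₀| * B₅ * θ ^ n := by ring

end Norms

/-! ### From the Laurent symbol to the polynomial `z ^ q (a(z) - lam)`. -/

theorem coeff_T_mul (l m : ℤ) (f : LaurentPolynomial ℂ) :
    (LaurentPolynomial.T l * f).coeff m = f.coeff (m - l) := by
  rw [LaurentPolynomial.T, AddMonoidAlgebra.coeff_single_mul_eq_mul_coeff (m - l), one_mul]
  intro x _
  exact ⟨fun h => by omega, fun h => by omega⟩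

theorem coeff_toLaurent_natCast (F : ℂ[X]) (m : ℕ) : (toLaurent F).coeff (m : ℤ) = F.coeff m := by
  rw [LaurentPolynomial.coeff_toLaurent]
  exact Finsupp.mapDomain_apply Nat.castEmbedding.injective _ m

theorem coeff_T_neg_mul_toLaurent (F : ℂ[X]) (r i j : ℕ) :
    (LaurentPolynomial.T (-(r : ℤ)) * toLaurent F).coeff ((i : ℤ) - j) =
      (F * X ^ j).coeff (r + i) := by
  rw [← coeff_toLaurent_natCast, mul_comm F, map_mul, map_pow, toLaurent_X, LaurentPolynomial.T_pow,
    coeff_T_mul, coeff_T_mul]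
  congr 1
  push_cast
  ring

/-- The polynomial `z ^ q a(z)`. -/
noncomputable def symbolPoly (p q : ℕ) (a : LaurentPolynomial ℂ) : ℂ[X] :=
  ∑ m ∈ Finset.range (p + q + 1), monomial m (a.coeff ((m : ℤ) - q))

section Symbol

variable {p q : ℕ} {a : LaurentPolynomial ℂ}

theorem IsBandedSymbol.coeff_symbolPoly (ha : IsBandedSymbol p q a) (m : ℕ) :
    (symbolPoly p q a).coeff m = a.coeff ((m : ℤ) - q) := by
  rw [symbolPoly, finsetSum_coeff]
  simp only [coeff_monomial, Finset.sum_ite_eq', Finset.mem_range]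
  split_ifs with h
  · rfl
  · by_contra h0
    have := Finset.mem_Icc.mp (ha.support_subset (Finsupp.mem_support_iff.mpr (Ne.symm h0)))
    omega

theorem IsBandedSymbol.eq_T_mul_toLaurent (ha : IsBandedSymbol p q a) :
    a = LaurentPolynomial.T (-(q : ℤ)) * toLaurent (symbolPoly p q a) := by
  apply LaurentPolynomial.ext
  intro m
  rw [coeff_T_mul]
  by_cases hm : -(q : ℤ) ≤ m
  · obtain ⟨l, hl⟩ := Int.eq_ofNat_of_zero_le (by omega : 0 ≤ m - -(q : ℤ))
    rw [hl, coeff_toLaurent_natCast, ha.coeff_symbolPoly]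
    congr 1
    omega
  · have h1 : a.coeff m = 0 := by
      by_contra h
      have := Finset.mem_Icc.mp (ha.support_subset (Finsupp.mem_support_iff.mpr h))
      omega
    rw [h1, LaurentPolynomial.coeff_toLaurent, Finsupp.mapDomain_of_notMem_range]
    rintro ⟨x, hx⟩
    have hx : (x : ℤ) = _ := hx
    omega

theorem IsBandedSymbol.sub_C_eq (ha : IsBandedSymbol p q a) (lam : ℂ) :
    a - LaurentPolynomial.C lam =
      LaurentPolynomial.T (-(q : ℤ)) * toLaurent (symbolPoly p q a - C lam * X ^ q) := by
  rw [map_sub, mul_sub, ← ha.eq_T_mul_toLaurent, toLaurent_C_mul_X_pow, mul_left_comm,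
    ← LaurentPolynomial.T_add]
  simp

theorem prod_Icc_eq_prod_fin {M : Type*} [CommMonoid M] (c : ℤ) (n : ℕ) (h : ℤ → M) :
    ∏ j ∈ Finset.Icc (c + 1) (c + n), h j = ∏ i : Fin n, h (c + 1 + (i : ℕ)) := by
  symm
  refine Finset.prod_bij (fun i _ => c + 1 + ((i : ℕ) : ℤ)) ?_ ?_ ?_ ?_
  · intro i _
    have := i.2
    exact Finset.mem_Icc.mpr ⟨by omega, by omega⟩
  · intro i _ j _ h
    apply Fin.ext
    omega
  · intro j hj
    have := Finset.mem_Icc.mp hj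
    exact ⟨⟨(j - c - 1).toNat, by omega⟩, Finset.mem_univ _, by simp; omega⟩
  · intro i _
    rfl

theorem IsBandedSymbol.factorization_iff (ha : IsBandedSymbol p q a) {N : ℕ} (hN : N = p + q)
    (lam : ℂ) (z : ℤ → ℂ) :
    a - LaurentPolynomial.C lam = LaurentPolynomial.C (a.coeff (p : ℤ)) *
        LaurentPolynomial.T (-(q : ℤ)) *
        ∏ j ∈ Finset.Icc (1 : ℤ) (p + q), (LaurentPolynomial.T 1 - LaurentPolynomial.C (z j)) ↔
      symbolPoly p q a - C lam * X ^ q =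
        C (a.coeff (p : ℤ)) * ∏ i : Fin N, (X - C (z (1 + (i : ℕ)))) := by
  have h1 : ∏ j ∈ Finset.Icc (1 : ℤ) (p + q),
      (LaurentPolynomial.T 1 - LaurentPolynomial.C (z j)) =
      toLaurent (∏ i : Fin N, (X - C (z (1 + (i : ℕ))))) := by
    have := prod_Icc_eq_prod_fin 0 N
      (fun j => LaurentPolynomial.T 1 - LaurentPolynomial.C (z j))
    rw [map_prod]
    simp only [zero_add] at this
    rw [hN] at this ⊢
    push_cast at this
    rw [this]
    simp
  rw [h1, ha.sub_C_eq, mul_comm (LaurentPolynomial.C _), mul_assoc, ← toLaurent_C, ← map_mul,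
    (LaurentPolynomial.isUnit_T _).mul_right_inj, toLaurent_inj]

theorem IsBandedSymbol.P_eq (ha : IsBandedSymbol p q a) {lam : ℂ} {k : ℤ} {r : ℕ}
    (hr : (r : ℤ) = q + k) {F : ℂ[X]}
    (hF : symbolPoly p q a - C lam * X ^ q = C (a.coeff (p : ℤ)) * F) (n : ℕ) :
    P a k n lam = a.coeff (p : ℤ) ^ n *
      (coeffMatrix (fun i : Fin n => r + i) (fun j : Fin n => F * X ^ (j : ℕ))).det := by
  have h : toeplitz n (LaurentPolynomial.T (-k) * (a - LaurentPolynomial.C lam)) =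
      a.coeff (p : ℤ) •
        coeffMatrix (fun i : Fin n => r + i) (fun j : Fin n => F * X ^ (j : ℕ)) := by
    ext i j
    rw [toeplitz, Matrix.of_apply, ha.sub_C_eq, ← mul_assoc, ← LaurentPolynomial.T_add, hF,
      show -k + -(q : ℤ) = -(r : ℤ) by omega, coeff_T_neg_mul_toLaurent]
    rw [Matrix.smul_apply, coeffMatrix, Matrix.of_apply, mul_assoc, coeff_C_mul, smul_eq_mul]
  rw [P, h, Matrix.det_smul, Fintype.card_fin]

/-! ### Compactness of the set of ordered solution lists. -/

/-- This is Cauchy's root bound: `lam` enters only the coefficient of `z ^ q`, and `q < p + q`, so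
the leading coefficient stays `a_p`. -/
theorem IsBandedSymbol.exists_norm_le (ha : IsBandedSymbol p q a) {K : Set ℂ} (hK : IsCompact K) :
    ∃ ρ : ℝ, ∀ lam ∈ K, ∀ t : ℂ, (symbolPoly p q a).eval t - lam * t ^ q = 0 → ‖t‖ ≤ ρ := by
  have hq := ha.one_le_q
  have hp := ha.one_le_p
  obtain ⟨Λ, hΛ⟩ := hK.isBounded.exists_norm_le
  set B : ℝ := ∑ m ∈ Finset.range (p + q), ‖(symbolPoly p q a).coeff m‖ + |Λ| with hB
  refine ⟨B / ‖a.coeff (p : ℤ)‖ + 1, fun lam hlam t ht => ?_⟩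
  set f := symbolPoly p q a - C lam * X ^ q with hf
  have hlc : f.coeff (p + q) = a.coeff (p : ℤ) := by
    rw [hf, coeff_sub, coeff_C_mul_X_pow, if_neg (by omega), ha.coeff_symbolPoly]
    simp
  have hdeg : f.natDegree = p + q := by
    apply le_antisymm
    · rw [natDegree_le_iff_coeff_eq_zero]
      intro m hm
      rw [hf, coeff_sub, coeff_C_mul_X_pow, if_neg (by omega), ha.coeff_symbolPoly, sub_zero]
      by_contra h
      have := Finset.mem_Icc.mp (ha.support_subset (Finsupp.mem_support_iff.mpr h))
      omega
    · apply le_natDegree_of_ne_zero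
      rw [hlc]; exact ha.coeff_p_ne_zero
  have hf0 : f ≠ 0 := by
    intro h
    rw [h, coeff_zero] at hlc
    exact ha.coeff_p_ne_zero hlc.symm
  have hroot : f.IsRoot t := by simpa [hf, IsRoot] using ht
  have h1 := (IsRoot.norm_lt_cauchyBound hf0 hroot).le
  have h2 : ‖t‖ ≤ (cauchyBound f : ℝ) := h1
  refine h2.trans ?_
  rw [cauchyBound, leadingCoeff, hdeg, hlc]
  push_cast
  gcongr
  have hB0 : 0 ≤ B := by positivity
  lift B to NNReal using hB0 with B' hB'
  rw [NNReal.coe_le_coe]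
  refine Finset.sup_le fun m hm => ?_
  rw [← NNReal.coe_le_coe, coe_nnnorm, hB, hf, coeff_sub, coeff_C_mul_X_pow]
  refine (norm_sub_le _ _).trans (add_le_add ?_ ?_)
  · exact Finset.single_le_sum (f := fun m => ‖(symbolPoly p q a).coeff m‖)
      (fun _ _ => norm_nonneg _) hm
  · split_ifs
    · exact (hΛ lam hlam).trans (le_abs_self _)
    · simp

/-- The ordered lists of solutions over a set of parameters. -/
def solutionSet (p q N : ℕ) (a : LaurentPolynomial ℂ) (K : Set ℂ) : Set (ℂ × (Fin N → ℂ)) :=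
  {x | x.1 ∈ K ∧ (∀ t : ℂ, (symbolPoly p q a).eval t - x.1 * t ^ q =
    a.coeff (p : ℤ) * ∏ i, (t - x.2 i)) ∧ ∀ i j, i ≤ j → ‖x.2 i‖ ≤ ‖x.2 j‖}

/-- The factorization, tested at every point `t`, and the ordering are closed conditions, and the
roots are bounded over `K`. -/
theorem IsBandedSymbol.isCompact_solutionSet (ha : IsBandedSymbol p q a) (N : ℕ) {K : Set ℂ}
    (hK : IsCompact K) : IsCompact (solutionSet p q N a K) := by
  obtain ⟨ρ, hρ⟩ := ha.exists_norm_le hK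
  refine (hK.prod (isCompact_closedBall (0 : Fin N → ℂ) (max ρ 0))).of_isClosed_subset ?_ ?_
  · have h : solutionSet p q N a K = Prod.fst ⁻¹' K ∩
        ((⋂ t : ℂ, {x : ℂ × (Fin N → ℂ) | (symbolPoly p q a).eval t - x.1 * t ^ q =
          a.coeff (p : ℤ) * ∏ i, (t - x.2 i)}) ∩
        ⋂ i, ⋂ j, ⋂ _ : i ≤ j, {x : ℂ × (Fin N → ℂ) | ‖x.2 i‖ ≤ ‖x.2 j‖}) := by
      ext x
      simp [solutionSet]
    rw [h]
    refine (hK.isClosed.preimage continuous_fst).inter (IsClosed.inter ?_ ?_)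
    · exact isClosed_iInter fun t => isClosed_eq (by fun_prop) (by fun_prop)
    · exact isClosed_iInter fun i => isClosed_iInter fun j => isClosed_iInter fun _ =>
        isClosed_le (by fun_prop) (by fun_prop)
  · rintro ⟨lam, ζ⟩ ⟨h1, h2, -⟩
    refine ⟨h1, ?_⟩
    rw [mem_closedBall_zero_iff, pi_norm_le_iff_of_nonneg (le_max_right _ _)]
    intro i
    refine (hρ lam h1 (ζ i) ?_).trans (le_max_left _ _)
    rw [h2 (ζ i), Finset.prod_eq_zero (Finset.mem_univ i) (sub_self _), mul_zero]

theorem IsBandedSymbol.eq_of_mem_solutionSet {N : ℕ} {K : Set ℂ}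
    {x : ℂ × (Fin N → ℂ)} (hx : x ∈ solutionSet p q N a K) :
    symbolPoly p q a - C x.1 * X ^ q = C (a.coeff (p : ℤ)) * ∏ i, (X - C (x.2 i)) := by
  apply Polynomial.funext
  intro t
  simpa [eval_prod] using hx.2.1 t

theorem IsOrderedSolutions.mem_solutionSet (ha : IsBandedSymbol p q a) {N : ℕ} (hN : N = p + q)
    {K : Set ℂ} {lam : ℂ} (hlam : lam ∈ K) {z : ℤ → ℂ} (hz : IsOrderedSolutions p q a lam z) :
    (lam, fun i : Fin N => z (1 + (i : ℕ))) ∈ solutionSet p q N a K := by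
  refine ⟨hlam, fun t => ?_, fun i j hij => ?_⟩
  · have := congrArg (eval t) ((ha.factorization_iff hN lam z).mp hz.factorization)
    simpa [eval_prod] using this
  · have hij : (i : ℕ) ≤ j := hij
    have := j.2
    exact hz.norm_le_norm _ _ (by omega) (by omega) (by omega)

/-- Any member of the solution set is an admissible numbering, so equality of the two moduli would
itself place `lam` in `Γ_k`. -/
theorem IsBandedSymbol.norm_lt_of_mem_solutionSet (ha : IsBandedSymbol p q a) {r s : ℕ}
    (hN : r + s = p + q) {k : ℤ} (hr : (r : ℤ) = q + k) {K : Set ℂ} (hKΓ : K ⊆ (Gam p q a k)ᶜ)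
    {x : ℂ × (Fin (r + s) → ℂ)} (hx : x ∈ solutionSet p q (r + s) a K) (i j : Fin (r + s))
    (hi : (i : ℕ) + 1 = r) (hj : (j : ℕ) = r) : ‖x.2 i‖ < ‖x.2 j‖ := by
  refine lt_of_le_of_ne (hx.2.2 i j (Fin.mk_le_mk.mpr (by omega))) fun h => hKΓ hx.1 ?_
  set z : ℤ → ℂ := fun l => if h : (l - 1).toNat < r + s then x.2 ⟨(l - 1).toNat, h⟩ else 0
    with hz
  have hz1 : ∀ (l : ℤ) (t : Fin (r + s)), l = 1 + (t : ℕ) → z l = x.2 t := by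
    intro l t hl
    have h1 : (l - 1).toNat = t := by omega
    have h2 : (l - 1).toNat < r + s := by omega
    rw [hz]
    simp only [h2, dif_pos]
    exact congrArg x.2 (Fin.ext h1)
  refine ⟨z, ⟨?_, ?_⟩, ?_⟩
  · rw [ha.factorization_iff hN, eq_of_mem_solutionSet hx]
    congr 1
    exact Finset.prod_congr rfl fun t _ => by rw [hz1 _ t rfl]
  · intro l m hl hlm hm
    rw [hz1 l ⟨(l - 1).toNat, by omega⟩ (by simp; omega),
      hz1 m ⟨(m - 1).toNat, by omega⟩ (by simp; omega)]
    exact hx.2.2 _ _ (Fin.mk_le_mk.mpr (by omega))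
  · rw [hz1 (q + k) i (by omega), hz1 (q + k + 1) j (by omega), h]

end Symbol

/-- A maximum is attained; `b` serves as the bound when `S` is empty and keeps `δ` from being too
small. -/
theorem _root_.IsCompact.exists_lt_forall_le {α : Type*} [TopologicalSpace α] {S : Set α}
    (hS : IsCompact S) {f : α → ℝ} (hf : ContinuousOn f S) {b c : ℝ} (hbc : b < c)
    (h : ∀ x ∈ S, f x < c) :
    ∃ δ, b ≤ δ ∧ δ < c ∧ ∀ x ∈ S, f x ≤ δ := by
  rcases S.eq_empty_or_nonempty with rfl | hne
  · exact ⟨b, le_rfl, hbc, by simp⟩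
  · obtain ⟨x, hx, hmax⟩ := hS.exists_isMaxOn hne hf
    exact ⟨max b (f x), le_max_left _ _, max_lt hbc (h x hx),
      fun y hy => (hmax hy).trans (le_max_right _ _)⟩

end BandedToeplitz

/-! ### Assembly: splitting the roots and matching the constants. -/

theorem mainTheorem3 (p q : ℕ) (a : LaurentPolynomial ℂ)
    (ha : BandedToeplitz.IsBandedSymbol p q a)
    (z : ℂ → ℤ → ℂ) (hz : ∀ lam : ℂ, BandedToeplitz.IsOrderedSolutions p q a lam (z lam))
    (k : ℤ) (hk : -(q : ℤ) + 1 ≤ k) (hk' : k ≤ (p : ℤ) - 1)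
    (K : Set ℂ) (hK : IsCompact K) (hKΓ : K ⊆ (BandedToeplitz.Gam p q a k)ᶜ) :
    ∃ c : ℝ, 0 < c ∧ ∃ (B : ℝ) (N : ℕ), ∀ n : ℕ, N ≤ n → ∀ lam ∈ K, ∃ R : ℂ,
      BandedToeplitz.P a k n lam =
        BandedToeplitz.w p a k (BandedToeplitz.Mk p q k) (z lam) ^ n *
          BandedToeplitz.CM p q k (BandedToeplitz.Mk p q k) (z lam) * (1 + R) ∧
      ‖R‖ ≤ B * Real.exp (-c * n) := by
  obtain ⟨r, hr⟩ := Int.eq_ofNat_of_zero_le (by omega : 0 ≤ (q : ℤ) + k)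
  obtain ⟨s, hs⟩ := Int.eq_ofNat_of_zero_le (by omega : 0 ≤ (p : ℤ) - k)
  have hN : r + s = p + q := by omega
  have hr0 : 0 < r := by omega
  have hs0 : 0 < s := by omega
  set S₀ := BandedToeplitz.solutionSet p q (r + s) a K with hS₀
  have hS₀c : IsCompact S₀ := ha.isCompact_solutionSet (r + s) hK
  set i₀ : Fin (r + s) := ⟨r - 1, by omega⟩ with hi₀
  set j₀ : Fin (r + s) := ⟨r, by omega⟩ with hj₀
  have hlt : ∀ x ∈ S₀, ‖x.2 i₀‖ < ‖x.2 j₀‖ := fun x hx =>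
    ha.norm_lt_of_mem_solutionSet hN hr.symm hKΓ hx i₀ j₀ (by simp [hi₀]; omega) rfl
  have hpos : ∀ x ∈ S₀, 0 < ‖x.2 j₀‖ := fun x hx => (norm_nonneg _).trans_lt (hlt x hx)
  have hcont : ∀ i, Continuous fun x : ℂ × (Fin (r + s) → ℂ) => ‖x.2 i‖ := fun i => by fun_prop
  obtain ⟨δ, hδ0, hδ1, hδ⟩ := hS₀c.exists_lt_forall_le (b := 0) (c := 1)
    (f := fun x => ‖x.2 i₀‖ / ‖x.2 j₀‖)
    ((hcont i₀).continuousOn.div (hcont j₀).continuousOn fun x hx => (hpos x hx).ne') one_pos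
    fun x hx => (div_lt_one (hpos x hx)).mpr (hlt x hx)
  -- Negation turns the upper bound into a positive lower bound `-μ` for the large roots.
  obtain ⟨μ, -, hμ0, hμ⟩ := hS₀c.exists_lt_forall_le (b := -1) (c := 0)
    (f := fun x => -‖x.2 j₀‖) (hcont j₀).neg.continuousOn (by norm_num)
    fun x hx => neg_lt_zero.mpr (hpos x hx)
  have hsplit : Continuous fun x : ℂ × (Fin (r + s) → ℂ) =>
      ((fun i => x.2 (Fin.castAdd s i), fun j => x.2 (Fin.natAdd r j)) :
        (Fin r → ℂ) × (Fin s → ℂ)) := by fun_prop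
  have hle : ∀ x ∈ S₀, ∀ i j, ‖x.2 (Fin.castAdd s i)‖ ≤ δ * ‖x.2 (Fin.natAdd r j)‖ := by
    intro x hx i j
    have e1 : ‖x.2 (Fin.castAdd s i)‖ ≤ ‖x.2 i₀‖ :=
      hx.2.2 _ _ (Fin.mk_le_mk.mpr (by have := i.2; omega))
    have e2 : ‖x.2 j₀‖ ≤ ‖x.2 (Fin.natAdd r j)‖ := hx.2.2 _ _ (Fin.mk_le_mk.mpr (by omega))
    have e3 : ‖x.2 i₀‖ ≤ δ * ‖x.2 j₀‖ := (div_le_iff₀ (hpos x hx)).mp (hδ x hx)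
    exact (e1.trans e3).trans (mul_le_mul_of_nonneg_left e2 hδ0)
  have hge : ∀ x ∈ S₀, ∀ j, -μ ≤ ‖x.2 (Fin.natAdd r j)‖ := by
    intro x hx j
    have e2 : ‖x.2 j₀‖ ≤ ‖x.2 (Fin.natAdd r j)‖ := hx.2.2 _ _ (Fin.mk_le_mk.mpr (by omega))
    have := hμ x hx
    linarith
  obtain ⟨c, hc, B, N, hmain⟩ := BandedToeplitz.exists_det_toeplitz_asymptotics r s hs0 _
    (hS₀c.image hsplit) δ (-μ) hδ0 hδ1 (by linarith)
    (by rintro _ ⟨x, hx, rfl⟩; exact hle x hx) (by rintro _ ⟨x, hx, rfl⟩; exact hge x hx)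
  refine ⟨c, hc, B, N, fun n hn lam hlam => ?_⟩
  -- The given numbering is used only as a point of the compact set, so its dependence on `lam` may
  -- be arbitrary.
  have hx := (hz lam).mem_solutionSet ha hN hlam
  obtain ⟨R, hR, hRb⟩ := hmain n hn _ (Set.mem_image_of_mem _ hx)
  refine ⟨R, ?_, hRb⟩
  have hfac := BandedToeplitz.IsBandedSymbol.eq_of_mem_solutionSet hx
  rw [Fin.prod_univ_add] at hfac
  rw [ha.P_eq hr.symm hfac n]
  dsimp only at hR ⊢
  have hlex := hle _ hx
  have hgex := hge _ hx
  dsimp only at hlex hgex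
  simp only [Fin.val_castAdd, Fin.val_natAdd] at hR hlex hgex ⊢
  have hMk : BandedToeplitz.Mk p q k = Finset.Icc ((r : ℤ) + 1) (r + s) := by
    rw [BandedToeplitz.Mk, hr]
    congr 1
    omega
  have hMkc : Finset.Icc (1 : ℤ) (p + q) \ BandedToeplitz.Mk p q k =
      Finset.Icc ((0 : ℤ) + 1) (0 + r) := by
    ext l
    simp only [hMk, Finset.mem_sdiff, Finset.mem_Icc]
    omega
  have hidx : ∀ j : Fin s, (r : ℤ) + 1 + ((j : ℕ) : ℤ) = 1 + ((r + j : ℕ) : ℤ) := by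
    intro j; push_cast; ring
  have hw : BandedToeplitz.w p a k (BandedToeplitz.Mk p q k) (z lam) =
      a.coeff (p : ℤ) * ((-1) ^ s * ∏ j : Fin s, z lam (1 + ((r + j : ℕ) : ℤ))) := by
    rw [BandedToeplitz.w, hMk, BandedToeplitz.prod_Icc_eq_prod_fin, hs, zpow_natCast]
    simp only [hidx]
    ring
  have hCM : BandedToeplitz.CM p q k (BandedToeplitz.Mk p q k) (z lam) =
      (∏ j : Fin s, z lam (1 + ((r + j : ℕ) : ℤ))) ^ r *
        (∏ i : Fin r, ∏ j : Fin s,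
          (z lam (1 + ((r + j : ℕ) : ℤ)) - z lam (1 + ((i : ℕ) : ℤ))))⁻¹ := by
    rw [BandedToeplitz.CM, hMkc, hMk, BandedToeplitz.prod_Icc_eq_prod_fin,
      BandedToeplitz.prod_Icc_eq_prod_fin]
    simp only [hr, zpow_natCast, hidx, Finset.prod_pow]
    rw [Finset.prod_comm, BandedToeplitz.prod_Icc_eq_prod_fin]
    simp only [Finset.prod_inv_distrib, zero_add]
  -- A coincidence `y_j = x_i` would give `‖y_j‖ ≤ δ ‖y_j‖` with `δ < 1` and `‖y_j‖ ≥ -μ > 0`.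
  have hne : ∏ i : Fin r, ∏ j : Fin s,
      (z lam (1 + ((r + j : ℕ) : ℤ)) - z lam (1 + ((i : ℕ) : ℤ))) ≠ 0 := by
    refine Finset.prod_ne_zero_iff.mpr fun i _ => Finset.prod_ne_zero_iff.mpr fun j _ h => ?_
    have e1 := hlex i j
    have e2 := hgex j
    rw [← sub_eq_zero.mp h] at e1
    nlinarith
  rw [hw, hCM, eq_div_of_mul_eq hne hR, mul_pow, div_eq_mul_inv]
  ring
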